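/- Let $i,j,k$ be positive integers. Let $\Delta\subset\mathbb{R}^2$ be the triangle with vertices $(0,0),(i,0),(i,j)$ and let $L$ be the segment from $(0,0)$ to $(i,j)$. Let $C_k$ be the set of sequences $((x_l,y_l))_{1\le l\le k}$ of pairs of positive integers with $\sum_l x_l=i$, $\sum_l y_l=j$ and $\frac{y_1}{x_1}<\cdots<\frac{y_k}{x_k}$. A convex $m$-gon ($m\ge 2$) means the convex hull of finitely many points of $\mathbb{Z}^2$ that has exactly $m$ vertices (extreme points); segments count as $2$-gons, and a segment is an edge of itself. Then the map that sends $((x_l,y_l))_{1\le l\le k}$ to the convex hull $P$ of the points $(x_1+\cdots+x_m,\;y_1+\cdots+y_m)$, $0\le m\le k$, is a bijection from $C_k$ onto the set of convex $(k+1)$-gons $P\subseteq\Delta$ that have $L$ as an edge and meet the horizontal and vertical edges of $\Delta$ only in the points $(0,0)$ and $(i,j)$. Moreover, if $P$ corresponds to $((x_l,y_l))_{1\le l\le k}$, then $$\frac12\left(\sum_{1\le l_1<l_2\le k}(x_{l_1}y_{l_2}-x_{l_2}y_{l_1})+\sum_{1\le l\le k}\gcd(x_l,y_l)\right)=i(P)+b(P)-1-\frac12\gcd(i,j),$$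 where $i(P)$ and $b(P)$ are the numbers of points of $\mathbb{Z}^2$ in the interior and on the boundary of $P$, respectively (interior and boundary taken in $\mathbb{R}^2$, so that all lattice points of a $2$-gon are boundary points). -/

import Mathlib

/-- `C_k` for given `i`, `j`: sequences of `k` pairs `(x_l, y_l)` of positive integers with
`∑ x_l = i`, `∑ y_l = j` and strictly increasing slopes `y_l / x_l`. -/
def slopeSequences (i j k : ℕ) : Set (Fin k → ℕ × ℕ) :=
  {c | (∀ l, 0 < (c l).1 ∧ 0 < (c l).2) ∧ ∑ l, (c l).1 = i ∧ ∑ l, (c l).2 = j ∧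
    StrictMono fun l => ((c l).2 : ℚ) / ((c l).1 : ℚ)}

/-- The points of the plane with integer coordinates. -/
def latticePoints : Set (ℝ × ℝ) :=
  Set.range fun p : ℤ × ℤ => ((p.1 : ℝ), (p.2 : ℝ))

/-- `P` is a convex `m`-gon with lattice vertices (`2 ≤ m`, a segment being a `2`-gon): the convex
hull of its vertices (extreme points), which are exactly `m` in number and are lattice points. -/
def IsConvexLatticeGon (m : ℕ) (P : Set (ℝ × ℝ)) : Prop :=
  2 ≤ m ∧ P.extremePoints ℝ ⊆ latticePoints ∧ (P.extremePoints ℝ).ncard = m ∧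
    P = convexHull ℝ (P.extremePoints ℝ)

/-- The segment from `a` to `b` is an edge of the convex polygon `P`: it is nondegenerate and it is
the intersection of `P` with a supporting line. (A `2`-gon is an edge of itself, by means of the
zero functional or of the line that contains it.) -/
def IsEdge (P : Set (ℝ × ℝ)) (a b : ℝ × ℝ) : Prop :=
  a ≠ b ∧ IsExposed ℝ P (segment ℝ a b)

/-- The triangle `Δ` with vertices `(0,0)`, `(i,0)`, `(i,j)`. -/
def triangleDelta (i j : ℕ) : Set (ℝ × ℝ) :=
  convexHull ℝ {((0 : ℝ), (0 : ℝ)), ((i : ℝ), (0 : ℝ)), ((i : ℝ), (j : ℝ))}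

/-- The union of the horizontal and the vertical edge of `Δ`. -/
def legsDelta (i j : ℕ) : Set (ℝ × ℝ) :=
  segment ℝ ((0 : ℝ), (0 : ℝ)) ((i : ℝ), (0 : ℝ)) ∪
    segment ℝ ((i : ℝ), (0 : ℝ)) ((i : ℝ), (j : ℝ))

/-- The convex lattice `m`-gons that lie in `Δ`, have the segment `L` from `(0,0)` to `(i,j)` as an
edge, and meet the horizontal and vertical edges of `Δ` nowhere but in the endpoints of `L`. -/
def gonsInDelta (i j m : ℕ) : Set (Set (ℝ × ℝ)) :=
  {P | IsConvexLatticeGon m P ∧ P ⊆ triangleDelta i j ∧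
    P ∩ legsDelta i j ⊆ {((0 : ℝ), (0 : ℝ)), ((i : ℝ), (j : ℝ))} ∧
    IsEdge P ((0 : ℝ), (0 : ℝ)) ((i : ℝ), (j : ℝ))}

/-- The partial sum `(x_1 + ⋯ + x_m, y_1 + ⋯ + y_m)`, for `0 ≤ m ≤ k`. -/
def pathVertex {k : ℕ} (c : Fin k → ℕ × ℕ) (m : Fin (k + 1)) : ℝ × ℝ :=
  (∑ l with l.castSucc < m, ((c l).1 : ℝ), ∑ l with l.castSucc < m, ((c l).2 : ℝ))

/-- The convex polygon spanned by all the partial sums of the sequence. -/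
def pathPolygon {k : ℕ} (c : Fin k → ℕ × ℕ) : Set (ℝ × ℝ) :=
  convexHull ℝ (Set.range (pathVertex c))

/-- `i(P)`: the number of lattice points in the interior of `P`. -/
noncomputable def interiorCount (P : Set (ℝ × ℝ)) : ℕ :=
  (latticePoints ∩ interior P).ncard

/-- `b(P)`: the number of lattice points on the boundary of `P`; all of those of a `2`-gon. -/
noncomputable def boundaryCount (P : Set (ℝ × ℝ)) : ℕ :=
  (latticePoints ∩ frontier P).ncard

/-! Steps of increasing slope trace a strictly convex path from the origin to `(i, j)`. For a real
`s` between the slopes before and after a vertex, `y - s * x` has its strict minimum over the path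
there (`exists_strict_support`), so the extreme points of the hull are exactly the path vertices.
Comparison with the two ends puts the path below the diagonal, which makes `L` an edge. The extreme
points, sorted by abscissa, give back the steps, whence injectivity.

Conversely, for an admissible `P`, every extreme point other than the ends of `L` lies below `L`
with nothing of `P` beneath it. Hence distinct extreme points have distinct abscissas, and
consecutive chords have increasing slopes (`extremePoint_slope_lt`); avoidance of the legs makes all
differences positive, and these differences are the sequence sought.

The formula involves only `i(P) + b(P)`, the number of all lattice points of the compact set `P`.
They are counted on vertical lines: floors along the diagonal minus ceilings along the path, both
evaluated by `∑ ⌊b t / a⌋`, in which the gcd enters. Summation by parts turns the cross products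
into the same quantities. -/

/-! ### Linear functionals on convex hulls -/

/-- A combination with positive weights attains the bound `M` only if both points do, so the
condition cuts out a convex set. A singleton or a segment as `C` identifies the face where `M` is
attained; `C = Set.univ` leaves the bare inequality. -/
theorem convexHull_linear_le {S C : Set (ℝ × ℝ)} {a b M : ℝ} (hC : Convex ℝ C)
    (hS : ∀ p ∈ S, a * p.1 + b * p.2 ≤ M ∧ (a * p.1 + b * p.2 = M → p ∈ C))
    {p : ℝ × ℝ} (hp : p ∈ convexHull ℝ S) :
    a * p.1 + b * p.2 ≤ M ∧ (a * p.1 + b * p.2 = M → p ∈ C) := by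
  have hconv : Convex ℝ {p : ℝ × ℝ | a * p.1 + b * p.2 ≤ M ∧ (a * p.1 + b * p.2 = M → p ∈ C)} := by
    refine convex_iff_forall_pos.2 ?_
    rintro p ⟨hp, hp'⟩ q ⟨hq, hq'⟩ u v hu hv huv
    have hval : a * (u • p + v • q).1 + b * (u • p + v • q).2 =
        u * (a * p.1 + b * p.2) + v * (a * q.1 + b * q.2) := by
      simp; ring
    have hM : u * M + v * M = M := by rw [← add_mul, huv, one_mul]
    have h1 := mul_le_mul_of_nonneg_left hp hu.le
    have h2 := mul_le_mul_of_nonneg_left hq hv.le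
    simp only [Set.mem_ofPred_eq]
    rw [hval]
    refine ⟨by linarith, fun h => hC (hp' ?_) (hq' ?_) hu.le hv.le huv⟩
    · exact mul_left_cancel₀ hu.ne' (by linarith)
    · exact mul_left_cancel₀ hv.ne' (by linarith)
  exact convexHull_min (s := S) hS hconv hp

theorem mem_extremePoints_of_linear_lt {P : Set (ℝ × ℝ)} {v : ℝ × ℝ} {a b : ℝ} (hv : v ∈ P)
    (h : ∀ p ∈ P, a * p.1 + b * p.2 ≤ a * v.1 + b * v.2 ∧
      (a * p.1 + b * p.2 = a * v.1 + b * v.2 → p = v)) :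
    v ∈ P.extremePoints ℝ := by
  refine mem_extremePoints_iff_left.2 ⟨hv, ?_⟩
  rintro p hp q hq ⟨s, t, hs, ht, hst, rfl⟩
  obtain ⟨h1, h1'⟩ := h p hp
  obtain ⟨h2, -⟩ := h q hq
  refine h1' (le_antisymm h1 ?_)
  simp only [Prod.fst_add, Prod.snd_add, Prod.smul_fst, Prod.smul_snd, smul_eq_mul] at h1 h2 ⊢
  have hs' : s = 1 - t := by linarith
  subst hs'
  have : t * (a * p.1 + b * p.2 - (a * q.1 + b * q.2)) ≥ 0 := by nlinarith
  nlinarith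

/-! ### The triangle, its legs and its diagonal -/

theorem mem_triangleDelta {i j : ℕ} (hi : 0 < i) (hj : 0 < j) {p : ℝ × ℝ} :
    p ∈ triangleDelta i j ↔ 0 ≤ p.2 ∧ p.1 ≤ i ∧ i * p.2 ≤ j * p.1 := by
  have hi' : (0 : ℝ) < i := by exact_mod_cast hi
  have hj' : (0 : ℝ) < j := by exact_mod_cast hj
  constructor
  · intro hp
    have key : ∀ a b M : ℝ, 0 ≤ M → a * i ≤ M → a * i + b * j ≤ M →
        a * p.1 + b * p.2 ≤ M := by
      intro a b M h0 h1 h2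
      refine (convexHull_linear_le (C := Set.univ) convex_univ ?_ hp).1
      rintro q (rfl | rfl | rfl) <;> simpa
    have h1 := key 0 (-1) 0 le_rfl (by simp) (by simp)
    have h2 := key 1 0 i hi'.le (by simp) (by simp)
    have h3 := key (-j) i 0 le_rfl (by nlinarith) (by nlinarith)
    exact ⟨by linarith, by linarith, by linarith⟩
  · rintro ⟨h1, h2, h3⟩
    rw [triangleDelta, convexHull_insert (by simp), convexHull_pair]
    simp only [mem_convexJoin, Set.mem_singleton_iff, exists_eq_left]
    by_cases hx : p.1 = 0
    · have : p.2 = 0 := by rw [hx] at h3; nlinarith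
      refine ⟨(i, 0), left_mem_segment _ _ _, ?_⟩
      have : p = (0, 0) := Prod.ext hx this
      rw [this]; exact left_mem_segment _ _ _
    · have hx' : 0 < p.1 := by
        have : 0 ≤ (j : ℝ) * p.1 := le_trans (by positivity) h3
        exact lt_of_le_of_ne (nonneg_of_mul_nonneg_right this hj') (Ne.symm hx)
      -- The ray from the origin through `p` meets the vertical leg at this point.
      refine ⟨(i, i * p.2 / p.1), ⟨1 - i * p.2 / (j * p.1), i * p.2 / (j * p.1), ?_, by positivity,
        by ring, ?_⟩, ⟨1 - p.1 / i, p.1 / i, ?_, by positivity, by ring, ?_⟩⟩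
      · rw [sub_nonneg, div_le_one (by positivity)]; exact h3
      · ext
        · simp; field_simp; ring
        · simp; field_simp
      · rw [sub_nonneg, div_le_one (by positivity)]; exact h2
      · ext
        · simp; field_simp
        · simp; field_simp

theorem legsDelta_subset {i j : ℕ} {p : ℝ × ℝ} (hp : p ∈ legsDelta i j) :
    p.2 = 0 ∨ p.1 = i := by
  rcases hp with ⟨s, t, -, -, h, rfl⟩ | ⟨s, t, -, -, h, rfl⟩
  · left; simp
  · right; simp [← add_mul, h]

theorem mem_legsDelta_of_snd_eq_zero {i j : ℕ} (hi : 0 < i) {x : ℝ} (h0 : 0 ≤ x) (h1 : x ≤ i) :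
    (x, (0 : ℝ)) ∈ legsDelta i j := by
  have hi' : (0 : ℝ) < i := by exact_mod_cast hi
  refine Or.inl ⟨1 - x / i, x / i, ?_, by positivity, by ring, ?_⟩
  · rw [sub_nonneg, div_le_one hi']; exact h1
  · ext <;> simp; field_simp

theorem mem_legsDelta_of_fst_eq {i j : ℕ} (hj : 0 < j) {y : ℝ} (h0 : 0 ≤ y) (h1 : y ≤ j) :
    ((i : ℝ), y) ∈ legsDelta i j := by
  have hj' : (0 : ℝ) < j := by exact_mod_cast hj
  refine Or.inr ⟨1 - y / j, y / j, ?_, by positivity, by ring, ?_⟩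
  · rw [sub_nonneg, div_le_one hj']; exact h1
  · ext
    · simp; ring
    · simp; field_simp

theorem diagonal_mem_segment {i : ℕ} (j : ℕ) (hi : 0 < i) {x : ℝ} (h0 : 0 ≤ x) (h1 : x ≤ i) :
    (x, (j * x / i : ℝ)) ∈ segment ℝ ((0 : ℝ), (0 : ℝ)) ((i : ℝ), (j : ℝ)) := by
  have hi' : (0 : ℝ) < i := by exact_mod_cast hi
  refine ⟨1 - x / i, x / i, ?_, by positivity, by ring, ?_⟩
  · rw [sub_nonneg, div_le_one hi']; exact h1
  · ext
    · simp; field_simp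
    · simp; field_simp

/-! ### Partial sums and unimodal finite sequences -/

section Path

variable {k : ℕ} (c : Fin k → ℕ × ℕ)

theorem pathVertex_zero : pathVertex c 0 = (0, 0) := by
  simp [pathVertex]

theorem pathVertex_last : pathVertex c (Fin.last k) =
    (((∑ l, (c l).1 : ℕ) : ℝ), ((∑ l, (c l).2 : ℕ) : ℝ)) := by
  simp [pathVertex, Fin.castSucc_lt_last]

theorem pathVertex_succ (l : Fin k) :
    pathVertex c l.succ = pathVertex c l.castSucc + (((c l).1 : ℝ), ((c l).2 : ℝ)) := by
  have : (Finset.univ.filter fun l' : Fin k => l'.castSucc < l.succ) =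
      insert l (Finset.univ.filter fun l' : Fin k => l'.castSucc < l.castSucc) := by
    ext l'
    simp [le_iff_eq_or_lt]
  rw [pathVertex, this, Finset.sum_insert (by simp), Finset.sum_insert (by simp), add_comm,
    add_comm ((c l).2 : ℝ)]
  rfl

theorem apply_le_of_forall_fin_succ {f : Fin (k + 1) → ℝ} {m : Fin (k + 1)}
    (h1 : ∀ l : Fin k, l.castSucc < m → f l.succ ≤ f l.castSucc)
    (h2 : ∀ l : Fin k, m ≤ l.castSucc → f l.castSucc ≤ f l.succ) (n : Fin (k + 1)) :
    f m ≤ f n := by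
  rcases le_total m n with h | h
  · induction n using Fin.induction with
    | zero => rw [Fin.le_zero_iff.1 h]
    | succ l ih =>
      rcases h.eq_or_lt with rfl | h
      · rfl
      · have : m ≤ l.castSucc := Fin.le_castSucc_iff.2 h
        exact (ih this).trans (h2 l this)
  · induction n using Fin.reverseInduction with
    | last => rw [Fin.last_le_iff.1 h]
    | cast l ih =>
      rcases h.eq_or_lt with rfl | h
      · rfl
      · exact (ih (Fin.castSucc_lt_iff_succ_le.1 h)).trans (h1 l h)

theorem apply_lt_of_forall_fin_succ {f : Fin (k + 1) → ℝ} {m : Fin (k + 1)}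
    (h1 : ∀ l : Fin k, l.castSucc < m → f l.succ < f l.castSucc)
    (h2 : ∀ l : Fin k, m ≤ l.castSucc → f l.castSucc < f l.succ) {n : Fin (k + 1)} (hn : n ≠ m) :
    f m < f n := by
  rcases hn.lt_or_gt with h | h
  · have hk : n ≠ Fin.last k := fun e => (Fin.le_last m).not_gt (e ▸ h)
    obtain ⟨l, rfl⟩ := Fin.exists_castSucc_eq.2 hk
    refine lt_of_le_of_lt ?_ (h1 l h)
    exact apply_le_of_forall_fin_succ (fun l h => (h1 l h).le) (fun l h => (h2 l h).le) _
  · obtain ⟨l, rfl⟩ := Fin.exists_succ_eq.2 (Fin.ne_zero_of_lt h)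
    refine lt_of_le_of_lt ?_ (h2 l (Fin.le_castSucc_iff.2 h))
    exact apply_le_of_forall_fin_succ (fun l h => (h1 l h).le) (fun l h => (h2 l h).le) _

theorem sum_fin_succ_sub_castSucc {M : Type*} [AddCommGroup M] (f : Fin (k + 1) → M) :
    ∑ l : Fin k, (f l.succ - f l.castSucc) = f (Fin.last k) - f 0 := by
  rw [Finset.sum_sub_distrib, sub_eq_sub_iff_add_eq_add, add_comm]
  exact (Fin.sum_univ_succ f).symm.trans ((Fin.sum_univ_castSucc f).trans (add_comm _ _))

end Path

/-! ### The convex path: supporting lines, well-definedness, injectivity -/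

section SlopeSequence

variable {i j k : ℕ} {c : Fin k → ℕ × ℕ}

theorem slope_lt_slope (hc : c ∈ slopeSequences i j k) {l l' : Fin k} (h : l < l') :
    ((c l).2 : ℝ) / (c l).1 < ((c l').2 : ℝ) / (c l').1 := by
  have : ((c l).2 : ℚ) / (c l).1 < ((c l').2 : ℚ) / (c l').1 := hc.2.2.2 h
  rw [div_lt_div_iff₀ (by exact_mod_cast (hc.1 l).1) (by exact_mod_cast (hc.1 l').1)] at this ⊢
  exact_mod_cast this

theorem slope_le_slope (hc : c ∈ slopeSequences i j k) {l l' : Fin k} (h : l ≤ l') :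
    ((c l).2 : ℝ) / (c l).1 ≤ ((c l').2 : ℝ) / (c l').1 := by
  rcases h.eq_or_lt with rfl | h
  · rfl
  · exact (slope_lt_slope hc h).le

theorem pathVertex_last_of_mem (hc : c ∈ slopeSequences i j k) :
    pathVertex c (Fin.last k) = ((i : ℝ), (j : ℝ)) := by
  rw [pathVertex_last, hc.2.1, hc.2.2.1]

theorem fst_pos (hc : c ∈ slopeSequences i j k) (l : Fin k) : (0 : ℝ) < (c l).1 := by
  exact_mod_cast (hc.1 l).1

theorem snd_pos (hc : c ∈ slopeSequences i j k) (l : Fin k) : (0 : ℝ) < (c l).2 := by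
  exact_mod_cast (hc.1 l).2

theorem strictMono_pathVertex_fst (hc : c ∈ slopeSequences i j k) :
    StrictMono fun m => (pathVertex c m).1 := by
  refine Fin.strictMono_iff_lt_succ.2 fun l => ?_
  have := fst_pos hc l
  rw [pathVertex_succ]; simpa using this

theorem strictMono_pathVertex_snd (hc : c ∈ slopeSequences i j k) :
    StrictMono fun m => (pathVertex c m).2 := by
  refine Fin.strictMono_iff_lt_succ.2 fun l => ?_
  have := snd_pos hc l
  rw [pathVertex_succ]; simpa using this

theorem pathVertex_injective (hc : c ∈ slopeSequences i j k) : Function.Injective (pathVertex c) :=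
  fun _ _ h => (strictMono_pathVertex_fst hc).injective (congrArg Prod.fst h)

/-- Any `s` strictly between the slopes before `m` and those from `m` on makes `y - s * x` fall up
to `m` and rise afterwards. At the two ends one of the finsets is empty, which
`Order.exists_between_finsets` allows. -/
theorem exists_strict_support (hc : c ∈ slopeSequences i j k) (m : Fin (k + 1)) :
    ∃ s : ℝ, ∀ n, n ≠ m → (pathVertex c m).2 - s * (pathVertex c m).1 <
      (pathVertex c n).2 - s * (pathVertex c n).1 := by
  obtain ⟨s, h1, h2⟩ := Order.exists_between_finsets
    ((Finset.univ.filter fun l : Fin k => l.castSucc < m).image fun l =>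
      ((c l).2 : ℝ) / (c l).1)
    ((Finset.univ.filter fun l : Fin k => m ≤ l.castSucc).image fun l =>
      ((c l).2 : ℝ) / (c l).1) (by
      simp only [Finset.mem_image, Finset.mem_filter, Finset.mem_univ, true_and]
      rintro _ ⟨l, hl, rfl⟩ _ ⟨l', hl', rfl⟩
      exact slope_lt_slope hc (Fin.castSucc_lt_castSucc_iff.1 (hl.trans_le hl')))
  simp only [Finset.mem_image, Finset.mem_filter, Finset.mem_univ, true_and,
    forall_exists_index, and_imp, forall_apply_eq_imp_iff₂] at h1 h2
  refine ⟨s, fun n hn => apply_lt_of_forall_fin_succ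
    (f := fun m => (pathVertex c m).2 - s * (pathVertex c m).1) (fun l hl => ?_)
    (fun l hl => ?_) hn⟩
  · have := (div_lt_iff₀ (fst_pos hc l)).1 (h1 l hl)
    rw [pathVertex_succ]; simp; linarith
  · have := (lt_div_iff₀ (fst_pos hc l)).1 (h2 l hl)
    rw [pathVertex_succ]; simp; linarith

/-- The case where `s` is the slope of step `l` itself: the line through that edge supports the
path. -/
theorem slope_support (hc : c ∈ slopeSequences i j k) (l : Fin k) (n : Fin (k + 1)) :
    (pathVertex c l.castSucc).2 - ((c l).2 : ℝ) / (c l).1 * (pathVertex c l.castSucc).1 ≤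
      (pathVertex c n).2 - ((c l).2 : ℝ) / (c l).1 * (pathVertex c n).1 := by
  refine apply_le_of_forall_fin_succ
    (f := fun m => (pathVertex c m).2 - ((c l).2 : ℝ) / (c l).1 * (pathVertex c m).1)
    (fun l' hl => ?_) (fun l' hl => ?_) n
  · have := (div_le_iff₀ (fst_pos hc l')).1
      (slope_le_slope hc (Fin.castSucc_lt_castSucc_iff.1 hl).le)
    rw [pathVertex_succ]; simp; linarith
  · have := (le_div_iff₀ (fst_pos hc l')).1
      (slope_le_slope hc (Fin.castSucc_le_castSucc_iff.1 hl))
    rw [pathVertex_succ]; simp; linarith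

theorem pathVertex_below_diagonal (hc : c ∈ slopeSequences i j k) (m : Fin (k + 1)) :
    -(j : ℝ) * (pathVertex c m).1 + i * (pathVertex c m).2 ≤ 0 ∧
      (-(j : ℝ) * (pathVertex c m).1 + i * (pathVertex c m).2 = 0 →
        pathVertex c m ∈ segment ℝ ((0 : ℝ), (0 : ℝ)) ((i : ℝ), (j : ℝ))) := by
  by_cases h0 : m = 0
  · subst h0
    rw [pathVertex_zero]
    exact ⟨by simp, fun _ => left_mem_segment _ _ _⟩
  by_cases h1 : m = Fin.last k
  · subst h1
    rw [pathVertex_last_of_mem hc]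
    exact ⟨by simp [mul_comm], fun _ => right_mem_segment _ _ _⟩
  obtain ⟨s, hs⟩ := exists_strict_support hc m
  have e0 := hs 0 (Ne.symm h0)
  have e1 := hs (Fin.last k) (Ne.symm h1)
  have g0 := strictMono_pathVertex_fst hc (Fin.pos_iff_ne_zero.2 h0)
  have g1 := strictMono_pathVertex_fst hc (Fin.lt_last_iff_ne_last.2 h1)
  rw [pathVertex_zero] at e0
  rw [pathVertex_last_of_mem hc] at e1
  simp only [pathVertex_zero, pathVertex_last_of_mem hc] at g0 g1 e0 e1
  -- Weights `i - x` on `e0` and `x` on `e1`, where `x` is the abscissa of the vertex, eliminate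
  -- `s`.
  have : -(j : ℝ) * (pathVertex c m).1 + i * (pathVertex c m).2 < 0 := by
    nlinarith
  exact ⟨this.le, fun h => absurd h this.ne⟩

theorem pathPolygon_linear_le {C : Set (ℝ × ℝ)} {a b M : ℝ} (hC : Convex ℝ C)
    (h : ∀ m, a * (pathVertex c m).1 + b * (pathVertex c m).2 ≤ M ∧
      (a * (pathVertex c m).1 + b * (pathVertex c m).2 = M → pathVertex c m ∈ C))
    {p : ℝ × ℝ} (hp : p ∈ pathPolygon c) :
    a * p.1 + b * p.2 ≤ M ∧ (a * p.1 + b * p.2 = M → p ∈ C) :=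
  convexHull_linear_le hC (Set.forall_mem_range.2 h) hp

theorem pathVertex_mem_pathPolygon (m : Fin (k + 1)) : pathVertex c m ∈ pathPolygon c :=
  subset_convexHull _ _ ⟨m, rfl⟩

theorem extremePoints_pathPolygon (hc : c ∈ slopeSequences i j k) :
    (pathPolygon c).extremePoints ℝ = Set.range (pathVertex c) := by
  refine Set.Subset.antisymm extremePoints_convexHull_subset ?_
  rintro _ ⟨m, rfl⟩
  obtain ⟨s, hs⟩ := exists_strict_support hc m
  refine mem_extremePoints_of_linear_lt (a := s) (b := -1) (pathVertex_mem_pathPolygon m) ?_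
  intro p hp
  refine pathPolygon_linear_le (convex_singleton (pathVertex c m)) (fun n => ?_) hp
  by_cases hn : n = m
  · subst hn; simp
  · have := hs n hn
    exact ⟨by linarith, fun h => by linarith⟩

theorem segment_subset_pathPolygon (hc : c ∈ slopeSequences i j k) :
    segment ℝ ((0 : ℝ), (0 : ℝ)) ((i : ℝ), (j : ℝ)) ⊆ pathPolygon c := by
  refine (convex_convexHull ℝ _).segment_subset ?_ ?_
  · rw [← pathVertex_zero c]; exact pathVertex_mem_pathPolygon _
  · rw [← pathVertex_last_of_mem hc]; exact pathVertex_mem_pathPolygon _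

theorem pathPolygon_mem_gonsInDelta (hi : 0 < i) (hj : 0 < j) (hk : 1 ≤ k)
    (hc : c ∈ slopeSequences i j k) : pathPolygon c ∈ gonsInDelta i j (k + 1) := by
  have hi' : (0 : ℝ) < i := by exact_mod_cast hi
  have hj' : (0 : ℝ) < j := by exact_mod_cast hj
  have hfst := (strictMono_pathVertex_fst hc)
  have hsnd := (strictMono_pathVertex_snd hc)
  refine ⟨⟨by omega, ?_, ?_, ?_⟩, ?_, ?_, ?_, ?_⟩
  · rw [extremePoints_pathPolygon hc]
    rintro _ ⟨m, rfl⟩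
    exact ⟨(∑ l with l.castSucc < m, ((c l).1 : ℤ), ∑ l with l.castSucc < m, ((c l).2 : ℤ)),
      by simp [pathVertex]⟩
  · rw [extremePoints_pathPolygon hc, ← Set.image_univ,
      Set.ncard_image_of_injective _ (pathVertex_injective hc)]
    simp
  · rw [extremePoints_pathPolygon hc]; rfl
  · refine convexHull_min ?_ (convex_convexHull ℝ _)
    rintro _ ⟨m, rfl⟩
    refine (mem_triangleDelta hi hj).2 ⟨?_, ?_, ?_⟩
    · simpa [pathVertex_zero] using hsnd.monotone (Fin.zero_le m)
    · simpa [pathVertex_last_of_mem hc] using hfst.monotone (Fin.le_last m)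
    · linarith [(pathVertex_below_diagonal hc m).1]
  · rintro p ⟨hp, hleg⟩
    rcases legsDelta_subset hleg with h | h
    · left
      refine (pathPolygon_linear_le (c := c) (a := 0) (b := -1) (M := 0)
        (convex_singleton ((0 : ℝ), (0 : ℝ))) (fun n => ?_) hp).2 (by simp [h])
      rcases eq_or_ne n 0 with rfl | hn
      · simp [pathVertex_zero]
      · have := hsnd (Fin.pos_iff_ne_zero.2 hn)
        simp only [pathVertex_zero] at this
        exact ⟨by linarith, fun h => by linarith⟩
    · right
      refine (pathPolygon_linear_le (c := c) (a := 1) (b := 0) (M := i)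
        (convex_singleton ((i : ℝ), (j : ℝ))) (fun n => ?_) hp).2 (by simp [h])
      rcases eq_or_ne n (Fin.last k) with rfl | hn
      · simp [pathVertex_last_of_mem hc]
      · have := hfst (Fin.lt_last_iff_ne_last.2 hn)
        simp only [pathVertex_last_of_mem hc] at this
        exact ⟨by linarith, fun h => by linarith⟩
  · intro h
    exact hi'.ne (congrArg Prod.fst h)
  · intro _
    -- The functional `i * y - j * x` is at most `0` on the polygon, with equality exactly on `L`.
    refine ⟨(i : ℝ) • ContinuousLinearMap.snd ℝ ℝ ℝ - (j : ℝ) • ContinuousLinearMap.fst ℝ ℝ ℝ, ?_⟩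
    have hle := fun p (hp : p ∈ pathPolygon c) =>
      pathPolygon_linear_le (convex_segment _ _) (pathVertex_below_diagonal hc) hp
    ext p
    simp only [sub_apply, smul_apply,
      ContinuousLinearMap.coe_snd', ContinuousLinearMap.coe_fst', smul_eq_mul, Set.mem_ofPred_eq]
    constructor
    · intro hp
      refine ⟨segment_subset_pathPolygon hc hp, fun q hq => ?_⟩
      have := (hle q hq).1
      obtain ⟨s, t, -, -, -, rfl⟩ := hp
      simp
      linarith
    · rintro ⟨hp, h⟩
      have h0 := h (0, 0) (segment_subset_pathPolygon hc (left_mem_segment _ _ _))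
      simp at h0
      have := hle p hp
      exact this.2 (le_antisymm this.1 (by linarith))

/-- The extreme points determine the set of vertices, and strictly increasing abscissas determine
their order; the steps are consecutive differences. -/
theorem injOn_pathPolygon : Set.InjOn pathPolygon (slopeSequences i j k) := by
  intro c hc d hd h
  have hr : Set.range (pathVertex c) = Set.range (pathVertex d) := by
    rw [← extremePoints_pathPolygon hc, ← extremePoints_pathPolygon hd, h]
  have hfst : (fun m => (pathVertex c m).1) = fun m => (pathVertex d m).1 := by
    refine ((strictMono_pathVertex_fst hc).range_inj (strictMono_pathVertex_fst hd)).1 ?_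
    have : ∀ e : Fin k → ℕ × ℕ, Set.range (fun m => (pathVertex e m).1) =
        Prod.fst '' Set.range (pathVertex e) := fun e => Set.range_comp _ _
    rw [this, this, hr]
  have hv : ∀ m, pathVertex c m = pathVertex d m := by
    intro m
    obtain ⟨n, hn⟩ : pathVertex c m ∈ Set.range (pathVertex d) := hr ▸ ⟨m, rfl⟩
    have h1 : (pathVertex d n).1 = (pathVertex d m).1 := by
      rw [hn]; exact congrFun hfst m
    rw [← hn, (strictMono_pathVertex_fst hd).injective h1]
  funext l
  have h1 := pathVertex_succ c l
  rw [hv, hv, pathVertex_succ, add_right_inj, Prod.mk.injEq] at h1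
  exact Prod.ext (by exact_mod_cast h1.1.symm) (by exact_mod_cast h1.2.symm)

end SlopeSequence

/-! ### Sums of floors and ceilings along a lattice segment -/

section FloorSums

/-- After division by `g = gcd a b`, coprimality turns the condition into `a / g ∣ t`, which has `g`
solutions below `a`. -/
theorem card_range_filter_dvd_mul {a : ℕ} (b : ℕ) (ha : 0 < a) :
    ((Finset.range a).filter fun t => a ∣ b * t).card = Nat.gcd a b := by
  set g := Nat.gcd a b with hg
  have hgpos : 0 < g := Nat.gcd_pos_of_pos_left b ha
  obtain ⟨d, hd⟩ : g ∣ a := Nat.gcd_dvd_left a b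
  have hdpos : 0 < d := Nat.pos_of_mul_pos_left (hd ▸ ha)
  have hiff : ∀ t, a ∣ b * t ↔ d ∣ t := by
    intro t
    have hcop : Nat.Coprime (a / g) (b / g) := Nat.coprime_div_gcd_div_gcd hgpos
    have had : a / g = d := Nat.div_eq_of_eq_mul_right hgpos hd
    obtain ⟨e, he⟩ : g ∣ b := Nat.gcd_dvd_right a b
    have hbe : b / g = e := Nat.div_eq_of_eq_mul_right hgpos he
    rw [had, hbe] at hcop
    rw [hd, he, mul_assoc, Nat.mul_dvd_mul_iff_left hgpos]
    exact ⟨hcop.dvd_of_dvd_mul_left, fun h => h.mul_left e⟩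
  have : (Finset.range a).filter (fun t => a ∣ b * t) =
      (Finset.range g).image fun r => d * r := by
    ext t
    simp only [Finset.mem_filter, Finset.mem_range, Finset.mem_image, hiff]
    constructor
    · rintro ⟨h1, r, rfl⟩
      rw [hd, mul_comm g] at h1
      exact ⟨r, lt_of_mul_lt_mul_left h1 (Nat.zero_le d), rfl⟩
    · rintro ⟨r, h1, rfl⟩
      refine ⟨?_, dvd_mul_right _ _⟩
      rw [hd, mul_comm g]
      exact Nat.mul_lt_mul_of_pos_left h1 hdpos
  rw [this, Finset.card_image_of_injective _ (fun x y h => Nat.eq_of_mul_eq_mul_left hdpos h),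
    Finset.card_range]

theorem ceil_mul_div_eq {a : ℕ} (b t : ℕ) (ha : 0 < a) :
    ⌈(b * t : ℝ) / a⌉ = ⌊(b * t : ℝ) / a⌋ + 1 - if a ∣ b * t then 1 else 0 := by
  have ha' : (a : ℝ) ≠ 0 := by exact_mod_cast ha.ne'
  split_ifs with h
  · obtain ⟨r, hr⟩ := h
    have : (b * t : ℝ) / a = (r : ℤ) := by
      rw [div_eq_iff ha']
      push_cast
      rw [mul_comm (r : ℝ)]
      exact_mod_cast hr
    rw [this, Int.ceil_intCast, Int.floor_intCast]; ring
  · rw [sub_zero, Int.ceil_eq_floor_add_one_iff_notMem]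
    rintro ⟨r, hr⟩
    apply h
    rw [eq_div_iff ha'] at hr
    have : (a : ℤ) ∣ (b * t : ℕ) := ⟨r, by rw [mul_comm (a : ℤ)]; exact_mod_cast hr.symm⟩
    exact_mod_cast this

/-- The sum of `⌈b (t + 1) / a⌉` over `0 ≤ t < a`, by the reflection `t ↦ a - t`. -/
theorem sum_ceil_eq_sub_sum_floor {a : ℕ} (b : ℕ) (ha : 0 < a) :
    ∑ t ∈ Finset.range a, ⌈(b * (t + 1 : ℕ) : ℝ) / a⌉ =
      a * b - ∑ t ∈ Finset.range a, ⌊(b * t : ℝ) / a⌋ := by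
  have ha' : (a : ℝ) ≠ 0 := by exact_mod_cast ha.ne'
  rw [← Finset.sum_range_reflect, eq_sub_iff_add_eq, ← Finset.sum_add_distrib]
  rw [Finset.sum_congr rfl (g := fun _ => (b : ℤ))]
  · simp
  intro t ht
  have ht' := Finset.mem_range.1 ht
  have : (b * (a - 1 - t + 1 : ℕ) : ℝ) / a = (b : ℤ) - (b * t : ℝ) / a := by
    rw [show a - 1 - t + 1 = a - t by omega, Nat.cast_sub ht'.le]
    push_cast
    field_simp
  rw [this, sub_eq_add_neg, Int.ceil_intCast_add, Int.ceil_neg]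
  ring

/-- Reflection gives one relation between the floor and ceiling sums. Ceiling and floor differ by
one except at the `gcd a b` integral values, which gives a second; the shift of index in `h2` joins
them. -/
theorem two_mul_sum_floor {a : ℕ} (b : ℕ) (ha : 0 < a) :
    2 * ∑ t ∈ Finset.range a, ⌊(b * t : ℝ) / a⌋ = (a * b : ℤ) - a - b + Nat.gcd a b := by
  have ha' : (a : ℝ) ≠ 0 := by exact_mod_cast ha.ne'
  have h1 := sum_ceil_eq_sub_sum_floor b ha
  have h2 : ∑ t ∈ Finset.range a, ⌈(b * (t + 1 : ℕ) : ℝ) / a⌉ =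
      ∑ t ∈ Finset.range a, ⌈(b * t : ℝ) / a⌉ + b := by
    have := Finset.sum_range_succ' (fun t : ℕ => ⌈(b * t : ℝ) / a⌉) a
    rw [Finset.sum_range_succ] at this
    simp only [Nat.cast_zero, mul_zero, zero_div, Int.ceil_zero, add_zero] at this
    rw [← this, mul_div_cancel_right₀ _ ha', Int.ceil_natCast]
  have h3 : ∑ t ∈ Finset.range a, ⌈(b * t : ℝ) / a⌉ =
      ∑ t ∈ Finset.range a, ⌊(b * t : ℝ) / a⌋ + a - Nat.gcd a b := by
    rw [Finset.sum_congr rfl fun t _ => ceil_mul_div_eq b t ha, Finset.sum_sub_distrib,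
      Finset.sum_add_distrib, ← card_range_filter_dvd_mul b ha]
    simp
  linarith

theorem two_mul_sum_ceil {a : ℕ} (b : ℕ) (ha : 0 < a) :
    2 * ∑ t ∈ Finset.range a, ⌈(b * (t + 1 : ℕ) : ℝ) / a⌉ = (a * b : ℤ) + a + b - Nat.gcd a b := by
  have h1 := sum_ceil_eq_sub_sum_floor b ha
  have h2 := two_mul_sum_floor b ha
  linarith

end FloorSums

/-! ### Lattice points counted on vertical lines -/

section LatticeCount

variable {i j k : ℕ} {c : Fin k → ℕ × ℕ}

/-- The abscissa of a vertex of the path, as a natural number. -/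
def pathAbscissa (c : Fin k → ℕ × ℕ) (m : Fin (k + 1)) : ℕ :=
  ∑ l with l.castSucc < m, (c l).1

/-- The ordinate of a vertex of the path, as a natural number. -/
def pathOrdinate (c : Fin k → ℕ × ℕ) (m : Fin (k + 1)) : ℕ :=
  ∑ l with l.castSucc < m, (c l).2

theorem pathVertex_eq (c : Fin k → ℕ × ℕ) (m : Fin (k + 1)) :
    pathVertex c m = ((pathAbscissa c m : ℝ), (pathOrdinate c m : ℝ)) := by
  simp [pathVertex, pathAbscissa, pathOrdinate]

theorem pathAbscissa_zero : pathAbscissa c 0 = 0 := by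
  simp [pathAbscissa]

theorem pathOrdinate_zero : pathOrdinate c 0 = 0 := by
  simp [pathOrdinate]

theorem pathAbscissa_last (hc : c ∈ slopeSequences i j k) : pathAbscissa c (Fin.last k) = i := by
  simp [pathAbscissa, Fin.castSucc_lt_last, hc.2.1]

theorem pathAbscissa_succ (l : Fin k) :
    pathAbscissa c l.succ = pathAbscissa c l.castSucc + (c l).1 := by
  have := pathVertex_succ c l
  rw [pathVertex_eq, pathVertex_eq, Prod.mk_add_mk, Prod.mk.injEq] at this
  exact_mod_cast this.1

theorem pathOrdinate_succ (l : Fin k) :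
    pathOrdinate c l.succ = pathOrdinate c l.castSucc + (c l).2 := by
  have := pathVertex_succ c l
  rw [pathVertex_eq, pathVertex_eq, Prod.mk_add_mk, Prod.mk.injEq] at this
  exact_mod_cast this.2

/-- Over the abscissas of step `l` the polygon lies between that edge and the diagonal. The two
supporting lines bound it; conversely, the vertical segment from the edge to the diagonal has both
ends in the convex hull. -/
theorem mem_pathPolygon_of_mem_block (hi : 0 < i) (hc : c ∈ slopeSequences i j k) (l : Fin k) {x : ℝ}
    (h1 : pathAbscissa c l.castSucc ≤ x) (h2 : x ≤ pathAbscissa c l.succ) (y : ℝ) :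
    (x, y) ∈ pathPolygon c ↔
      pathOrdinate c l.castSucc + ((c l).2 : ℝ) / (c l).1 * (x - pathAbscissa c l.castSucc) ≤ y ∧
        y ≤ j * x / i := by
  have hi' : (0 : ℝ) < i := by exact_mod_cast hi
  have hl := fst_pos hc l
  have hsucc := pathVertex_succ c l
  constructor
  · intro h
    have e1 := (pathPolygon_linear_le (convex_segment _ _) (pathVertex_below_diagonal hc) h).1
    have e2 := (pathPolygon_linear_le (c := c) (a := ((c l).2 : ℝ) / (c l).1) (b := -1)
      (M := ((c l).2 : ℝ) / (c l).1 * (pathVertex c l.castSucc).1 - (pathVertex c l.castSucc).2)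
      (convex_univ) (fun m => ⟨by linarith [slope_support hc l m], fun _ => trivial⟩) h).1
    rw [pathVertex_eq] at e2
    simp only at e1 e2
    refine ⟨by linarith, ?_⟩
    rw [le_div_iff₀ hi']; linarith
  · rintro ⟨h3, h4⟩
    have hconv : Convex ℝ (pathPolygon c) := convex_convexHull ℝ _
    set z := pathOrdinate c l.castSucc + ((c l).2 : ℝ) / (c l).1 * (x - pathAbscissa c l.castSucc)
      with hz
    have hx0 : 0 ≤ x := le_trans (by positivity) h1
    have hxi : x ≤ i := by
      refine h2.trans ?_
      have := (strictMono_pathVertex_fst hc).monotone (Fin.le_last l.succ)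
      simpa only [pathVertex_last_of_mem hc, pathVertex_eq c l.succ] using this
    have hlow : (x, z) ∈ pathPolygon c := by
      refine hconv.segment_subset (pathVertex_mem_pathPolygon l.castSucc)
        (pathVertex_mem_pathPolygon l.succ) ?_
      have h2' : x ≤ pathAbscissa c l.castSucc + (c l).1 := by
        rw [pathAbscissa_succ] at h2; exact_mod_cast h2
      refine ⟨1 - (x - pathAbscissa c l.castSucc) / (c l).1,
        (x - pathAbscissa c l.castSucc) / (c l).1, ?_, div_nonneg (by linarith) hl.le, by ring, ?_⟩
      · rw [sub_nonneg, div_le_one hl]; linarith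
      · rw [hsucc, pathVertex_eq]
        ext
        · simp; field_simp; ring
        · simp [hz]; field_simp; ring
    have hup : (x, (j * x / i : ℝ)) ∈ pathPolygon c :=
      segment_subset_pathPolygon hc (diagonal_mem_segment j hi hx0 hxi)
    have hseg : y ∈ segment ℝ z (j * x / i) := by
      rw [segment_eq_Icc (h3.trans h4)]; exact ⟨h3, h4⟩
    obtain ⟨s, t, hs, ht, hst, rfl⟩ := hseg
    have := hconv hlow hup hs ht hst
    convert this using 1
    ext
    · simp [← add_mul, hst]
    · simp

theorem exists_block (hk : 1 ≤ k) {n : ℕ} {m : Fin (k + 1)} (h : n ≤ pathAbscissa c m) :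
    ∃ l : Fin k, pathAbscissa c l.castSucc ≤ n ∧ n ≤ pathAbscissa c l.succ := by
  induction m using Fin.induction with
  | zero =>
    rw [pathAbscissa_zero, Nat.le_zero] at h
    subst h
    refine ⟨⟨0, hk⟩, ?_, Nat.zero_le _⟩
    exact (pathAbscissa_zero (c := c)).le
  | succ l ih =>
    rcases le_total n (pathAbscissa c l.castSucc) with hle | hle
    · exact ih hle
    · exact ⟨l, hle, h⟩

/-- The lower boundary of `P` over the abscissa `n`. -/
noncomputable def lowerBoundary (P : Set (ℝ × ℝ)) (n : ℕ) : ℝ :=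
  sInf {y : ℝ | ((n : ℝ), y) ∈ P}

theorem lowerBoundary_of_mem_block (hi : 0 < i) (hc : c ∈ slopeSequences i j k) (l : Fin k) {n : ℕ}
    (h1 : pathAbscissa c l.castSucc ≤ n) (h2 : n ≤ pathAbscissa c l.succ) (hn : n ≤ i) :
    lowerBoundary (pathPolygon c) n =
      pathOrdinate c l.castSucc + ((c l).2 : ℝ) / (c l).1 * (n - pathAbscissa c l.castSucc) ∧
    lowerBoundary (pathPolygon c) n ≤ j * n / i := by
  have h := mem_pathPolygon_of_mem_block hi hc l (x := n) (by exact_mod_cast h1)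
    (by exact_mod_cast h2)
  have hmem := ((h _).1 (segment_subset_pathPolygon hc
    (diagonal_mem_segment j hi n.cast_nonneg (by exact_mod_cast hn))))
  have : {y : ℝ | ((n : ℝ), y) ∈ pathPolygon c} = Set.Icc (pathOrdinate c l.castSucc +
      ((c l).2 : ℝ) / (c l).1 * (n - pathAbscissa c l.castSucc)) (j * n / i) := Set.ext h
  rw [lowerBoundary, this, csInf_Icc (hmem.1.trans hmem.2)]
  exact ⟨rfl, hmem.1⟩

theorem lowerBoundary_le (hi : 0 < i) (hk : 1 ≤ k) (hc : c ∈ slopeSequences i j k) {n : ℕ}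
    (hn : n ≤ i) : lowerBoundary (pathPolygon c) n ≤ j * n / i := by
  obtain ⟨l, h1, h2⟩ := exists_block hk (c := c) (m := Fin.last k)
    (hn.trans (pathAbscissa_last hc).ge)
  exact (lowerBoundary_of_mem_block hi hc l h1 h2 hn).2

theorem natCast_mem_pathPolygon_iff (hi : 0 < i) (hk : 1 ≤ k) (hc : c ∈ slopeSequences i j k)
    {n : ℕ} (hn : n ≤ i) (y : ℝ) : ((n : ℝ), y) ∈ pathPolygon c ↔
      lowerBoundary (pathPolygon c) n ≤ y ∧ y ≤ j * n / i := by
  obtain ⟨l, h1, h2⟩ := exists_block hk (c := c) (m := Fin.last k)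
    (hn.trans (pathAbscissa_last hc).ge)
  rw [(lowerBoundary_of_mem_block hi hc l h1 h2 hn).1]
  exact mem_pathPolygon_of_mem_block hi hc l (by exact_mod_cast h1) (by exact_mod_cast h2) y

theorem latticePoints_inter_pathPolygon (hi : 0 < i) (hk : 1 ≤ k)
    (hc : c ∈ slopeSequences i j k) :
    latticePoints ∩ pathPolygon c =
      (fun p : (_ : ℕ) × ℤ => ((p.1 : ℝ), (p.2 : ℝ))) ''
        ((Finset.range (i + 1)).sigma fun n =>
          Finset.Icc ⌈lowerBoundary (pathPolygon c) n⌉ ⌊(j * n / i : ℝ)⌋ :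
            Finset ((_ : ℕ) × ℤ)) := by
  ext p
  simp only [Set.mem_image, Finset.mem_coe, Finset.mem_sigma, Finset.mem_range, Finset.mem_Icc,
    Int.ceil_le, Int.le_floor, Sigma.exists, Nat.lt_succ_iff]
  constructor
  · rintro ⟨⟨⟨a, b⟩, rfl⟩, hp⟩
    have h1 := (pathPolygon_linear_le (c := c) (a := -1) (b := 0) (M := 0) convex_univ
      (fun m => ⟨by rw [pathVertex_eq]; simp, fun _ => trivial⟩) hp).1
    have h2 := (pathPolygon_linear_le (c := c) (a := 1) (b := 0) (M := i) convex_univ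
      (fun m => ⟨by
        have := (strictMono_pathVertex_fst hc).monotone (Fin.le_last m)
        simp only [pathVertex_last_of_mem hc] at this
        linarith, fun _ => trivial⟩) hp).1
    simp only at h1 h2
    have ha0 : 0 ≤ a := by
      have : (0 : ℝ) ≤ a := by linarith
      exact_mod_cast this
    lift a to ℕ using ha0
    have hai : a ≤ i := by
      have : (a : ℝ) ≤ i := by simpa using h2
      exact_mod_cast this
    simp only [Int.cast_natCast] at hp
    exact ⟨a, b, ⟨hai, (natCast_mem_pathPolygon_iff hi hk hc hai _).1 hp⟩, by simp⟩
  · rintro ⟨a, b, ⟨hai, h⟩, rfl⟩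
    exact ⟨⟨(a, b), by simp⟩, (natCast_mem_pathPolygon_iff hi hk hc hai _).2 h⟩

theorem ncard_latticePoints_inter_pathPolygon (hi : 0 < i) (hk : 1 ≤ k)
    (hc : c ∈ slopeSequences i j k) :
    ((latticePoints ∩ pathPolygon c).ncard : ℤ) =
      ∑ n ∈ Finset.range (i + 1),
        (⌊(j * n / i : ℝ)⌋ + 1 - ⌈lowerBoundary (pathPolygon c) n⌉) := by
  rw [latticePoints_inter_pathPolygon hi hk hc, Set.ncard_image_of_injective, Set.ncard_coe_finset,
    Finset.card_sigma, Nat.cast_sum]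
  · refine Finset.sum_congr rfl fun n hn => ?_
    rw [Int.card_Icc, Int.toNat_of_nonneg]
    -- A slice may contain no lattice point, but then the ceiling exceeds the floor by exactly one,
    -- so the signed count is still `0`.
    have h := lowerBoundary_le hi hk hc (Nat.lt_succ_iff.1 (Finset.mem_range.1 hn))
    have h1 := Int.ceil_lt_add_one (lowerBoundary (pathPolygon c) n)
    have h2 := Int.lt_floor_add_one (j * n / i : ℝ)
    have : (⌈lowerBoundary (pathPolygon c) n⌉ : ℝ) < (⌊(j * n / i : ℝ)⌋ + 2 : ℤ) := by
      push_cast; linarith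
    have := Int.cast_lt.1 this
    omega
  · rintro ⟨a, b⟩ ⟨a', b'⟩ h
    simp only [Prod.mk.injEq, Nat.cast_inj, Int.cast_inj] at h
    obtain ⟨rfl, rfl⟩ := h
    rfl

theorem two_mul_sum_lowerBoundary (hi : 0 < i) (hk : 1 ≤ k) (hc : c ∈ slopeSequences i j k) :
    2 * ∑ n ∈ Finset.range (i + 1), ⌈lowerBoundary (pathPolygon c) n⌉ =
      ∑ l, (2 * ((c l).1 * pathOrdinate c l.castSucc : ℤ) +
        ((c l).1 * (c l).2 + (c l).1 + (c l).2 - Nat.gcd (c l).1 (c l).2)) := by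
  -- Telescoping over inclusive initial sums assigns to step `l` its right endpoint but not its left
  -- one, so no vertex is counted twice; abscissa `0` is left over and contributes `0`.
  have h := sum_fin_succ_sub_castSucc fun m : Fin (k + 1) =>
    ∑ n ∈ Finset.range (pathAbscissa c m + 1), ⌈lowerBoundary (pathPolygon c) n⌉
  simp only [pathAbscissa_last hc, pathAbscissa_zero, zero_add, Finset.sum_range_one] at h
  have h0 : lowerBoundary (pathPolygon c) 0 = 0 := by
    have := (lowerBoundary_of_mem_block hi hc ⟨0, hk⟩ (n := 0) (pathAbscissa_zero (c := c)).le
      (Nat.zero_le _) (Nat.zero_le _)).1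
    rw [this, show (⟨0, hk⟩ : Fin k).castSucc = 0 from rfl, pathAbscissa_zero, pathOrdinate_zero]
    simp
  rw [h0, Int.ceil_zero, sub_zero] at h
  rw [← h, Finset.mul_sum]
  refine Finset.sum_congr rfl fun l _ => ?_
  rw [pathAbscissa_succ, add_right_comm, Finset.sum_range_add, add_sub_cancel_left,
    ← two_mul_sum_ceil _ (hc.1 l).1, ← mul_add]
  congr 1
  have hlast : pathAbscissa c l.succ ≤ i := by
    have := (strictMono_pathVertex_fst hc).monotone (Fin.le_last l.succ)
    simp only [pathVertex_eq, pathAbscissa_last hc] at this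
    exact_mod_cast this
  have hsucc := pathAbscissa_succ (c := c) l
  rw [Finset.sum_congr rfl (g := fun t => (pathOrdinate c l.castSucc : ℤ) +
    ⌈((c l).2 * (t + 1 : ℕ) : ℝ) / (c l).1⌉), Finset.sum_add_distrib]
  · simp
  intro t ht
  have ht' := Finset.mem_range.1 ht
  rw [(lowerBoundary_of_mem_block hi hc l (n := pathAbscissa c l.castSucc + 1 + t) (by omega)
    (by omega) (by omega)).1, add_comm, Int.ceil_add_natCast, add_comm]
  congr 2
  push_cast
  ring

/-- For a fixed index, the `y` of the earlier steps sum to the ordinate `Y` at its start, those of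
the later steps to `j - Y - y`. -/
theorem sum_cross_products (hc : c ∈ slopeSequences i j k) :
    ∑ l₁, ∑ l₂ ∈ Finset.Ioi l₁,
        (((c l₁).1 : ℝ) * ((c l₂).2 : ℝ) - ((c l₂).1 : ℝ) * ((c l₁).2 : ℝ)) =
      i * j - ∑ l, (2 * ((c l).1 * pathOrdinate c l.castSucc : ℝ) + (c l).1 * (c l).2) := by
  have h1 : ∑ l₁, ∑ l₂ ∈ Finset.Ioi l₁, ((c l₂).1 : ℝ) * ((c l₁).2 : ℝ) =
      ∑ l, ((c l).1 * pathOrdinate c l.castSucc : ℝ) := by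
    rw [Finset.sum_comm' (t' := Finset.univ) (s' := fun l => Finset.Iio l) (by simp)]
    refine Finset.sum_congr rfl fun l _ => ?_
    rw [← Finset.mul_sum, pathOrdinate]
    simp only [Fin.castSucc_lt_castSucc_iff, Nat.cast_sum]
    congr 2
    ext; simp
  have h2 : ∑ l₁, ∑ l₂ ∈ Finset.Ioi l₁, ((c l₁).1 : ℝ) * ((c l₂).2 : ℝ) =
      ∑ l, ((c l).1 * (j - (pathOrdinate c l.castSucc + (c l).2)) : ℝ) := by
    refine Finset.sum_congr rfl fun l _ => ?_
    rw [← Finset.mul_sum]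
    congr 1
    have hj : (j : ℝ) = ∑ l, ((c l).2 : ℝ) := by exact_mod_cast hc.2.2.1.symm
    have hsplit := Finset.sum_filter_add_sum_filter_not Finset.univ
      (fun l' : Fin k => l'.castSucc < l.succ) (fun l' => ((c l').2 : ℝ))
    have hs : (pathOrdinate c l.succ : ℝ) = pathOrdinate c l.castSucc + (c l).2 := by
      exact_mod_cast pathOrdinate_succ l
    rw [hj, ← hs, eq_sub_iff_add_eq, ← hsplit, add_comm, pathOrdinate, Nat.cast_sum]
    congr 2
    ext l'
    simp
  have h3 : ∑ l, ((c l).1 * (j - (pathOrdinate c l.castSucc + (c l).2)) : ℝ) =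
      i * j - ∑ l, ((c l).1 * (pathOrdinate c l.castSucc + (c l).2) : ℝ) := by
    simp only [mul_sub, Finset.sum_sub_distrib]
    rw [← Finset.sum_mul, ← hc.2.1]
    simp
  simp only [Finset.sum_sub_distrib]
  rw [h1, h2, h3]
  simp only [mul_add, Finset.sum_add_distrib, ← Finset.mul_sum]
  ring

theorem isCompact_pathPolygon (c : Fin k → ℕ × ℕ) : IsCompact (pathPolygon c) :=
  (Set.finite_range _).isCompact_convexHull ℝ

theorem finite_latticePoints_inter_pathPolygon (hi : 0 < i) (hk : 1 ≤ k)
    (hc : c ∈ slopeSequences i j k) : (latticePoints ∩ pathPolygon c).Finite := by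
  rw [latticePoints_inter_pathPolygon hi hk hc]
  exact (Finset.finite_toSet _).image _

theorem interiorCount_add_boundaryCount (hi : 0 < i) (hk : 1 ≤ k)
    (hc : c ∈ slopeSequences i j k) :
    interiorCount (pathPolygon c) + boundaryCount (pathPolygon c) =
      (latticePoints ∩ pathPolygon c).ncard := by
  have hfin := finite_latticePoints_inter_pathPolygon hi hk hc
  have hcl := (isCompact_pathPolygon c).isClosed
  have hunion : latticePoints ∩ interior (pathPolygon c) ∪ latticePoints ∩ frontier (pathPolygon c) =
      latticePoints ∩ pathPolygon c := by
    rw [← Set.inter_union_distrib_left, ← closure_eq_interior_union_frontier, hcl.closure_eq]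
  rw [interiorCount, boundaryCount, ← hunion, Set.ncard_union_eq
    (disjoint_interior_frontier.mono Set.inter_subset_right Set.inter_subset_right)
    (hfin.subset (hunion ▸ Set.subset_union_left)) (hfin.subset (hunion ▸ Set.subset_union_right))]

theorem half_area_add_gcd_eq (hi : 0 < i) (hk : 1 ≤ k) (hc : c ∈ slopeSequences i j k) :
    (1 / 2 : ℝ) *
        (∑ l₁, ∑ l₂ ∈ Finset.Ioi l₁,
            (((c l₁).1 : ℝ) * ((c l₂).2 : ℝ) - ((c l₂).1 : ℝ) * ((c l₁).2 : ℝ)) +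
          ∑ l, (Nat.gcd (c l).1 (c l).2 : ℝ)) =
      (interiorCount (pathPolygon c) : ℝ) + (boundaryCount (pathPolygon c) : ℝ) - 1 -
        (1 / 2 : ℝ) * (Nat.gcd i j : ℝ) := by
  have h1 := ncard_latticePoints_inter_pathPolygon hi hk hc
  rw [← interiorCount_add_boundaryCount hi hk hc, Finset.sum_sub_distrib, Finset.sum_add_distrib,
    Finset.sum_range_succ, mul_div_cancel_right₀ _ (by exact_mod_cast hi.ne'),
    Int.floor_natCast] at h1
  have h2 := two_mul_sum_floor j hi
  have h3 := two_mul_sum_lowerBoundary hi hk hc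
  have h4 := sum_cross_products hc
  simp only [Finset.sum_const, Finset.card_range, nsmul_eq_mul, mul_one] at h1
  -- On the right: the diagonal floors for abscissas below `i`, the last floor `j`, and one unit for
  -- each of the `i + 1` slices, all doubled.
  have hcount : (2 : ℤ) * (interiorCount (pathPolygon c) + boundaryCount (pathPolygon c)) =
      (i * j - i - j + Nat.gcd i j) + 2 * j + 2 * (i + 1) -
      ∑ l, (2 * ((c l).1 * pathOrdinate c l.castSucc : ℤ) +
        ((c l).1 * (c l).2 + (c l).1 + (c l).2 - Nat.gcd (c l).1 (c l).2)) := by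
    push_cast at h1
    linarith
  have hreal := congrArg (Int.cast : ℤ → ℝ) hcount
  push_cast at hreal
  have hsi : ∑ l, ((c l).1 : ℝ) = i := by exact_mod_cast hc.2.1
  have hsj : ∑ l, ((c l).2 : ℝ) = j := by exact_mod_cast hc.2.2.1
  rw [h4]
  simp only [Finset.sum_add_distrib, Finset.sum_sub_distrib, hsi, hsj] at hreal ⊢
  linarith

end LatticeCount

/-! ### Recovering the sequence from a polygon -/

section Surjectivity

variable {i j k m : ℕ} {P : Set (ℝ × ℝ)}

theorem diagonal_subset_of_mem_gonsInDelta (hP : P ∈ gonsInDelta i j m) :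
    segment ℝ ((0 : ℝ), (0 : ℝ)) ((i : ℝ), (j : ℝ)) ⊆ P :=
  hP.2.2.2.2.subset

theorem convex_of_mem_gonsInDelta (hP : P ∈ gonsInDelta i j m) : Convex ℝ P := by
  rw [hP.1.2.2.2]; exact convex_convexHull ℝ _

theorem zero_mem_extremePoints (hi : 0 < i) (hj : 0 < j) (hP : P ∈ gonsInDelta i j m) :
    ((0 : ℝ), (0 : ℝ)) ∈ P.extremePoints ℝ := by
  have hi' : (0 : ℝ) < i := by exact_mod_cast hi
  have hj' : (0 : ℝ) < j := by exact_mod_cast hj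
  -- The ordinate would not do: it vanishes along the whole horizontal leg of the triangle, whereas
  -- `x = 0` only at the origin.
  refine mem_extremePoints_of_linear_lt (a := -1) (b := 0)
    (diagonal_subset_of_mem_gonsInDelta hP (left_mem_segment _ _ _)) fun p hp => ?_
  obtain ⟨h1, h2, h3⟩ := (mem_triangleDelta hi hj).1 (hP.2.1 hp)
  have hp0 : 0 ≤ p.1 := by
    have : 0 ≤ (j : ℝ) * p.1 := le_trans (by positivity) h3
    exact nonneg_of_mul_nonneg_right this hj'
  refine ⟨by simp; linarith, fun h => ?_⟩
  have hx : p.1 = 0 := by simp at h; linarith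
  refine Prod.ext hx ?_
  rw [hx, mul_zero] at h3
  exact le_antisymm (nonpos_of_mul_nonpos_right h3 hi') h1

theorem corner_mem_extremePoints (hi : 0 < i) (hj : 0 < j) (hP : P ∈ gonsInDelta i j m) :
    ((i : ℝ), (j : ℝ)) ∈ P.extremePoints ℝ := by
  have hi' : (0 : ℝ) < i := by exact_mod_cast hi
  have hj' : (0 : ℝ) < j := by exact_mod_cast hj
  refine mem_extremePoints_of_linear_lt (a := 0) (b := 1)
    (diagonal_subset_of_mem_gonsInDelta hP (right_mem_segment _ _ _)) fun p hp => ?_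
  obtain ⟨h1, h2, h3⟩ := (mem_triangleDelta hi hj).1 (hP.2.1 hp)
  have h4 : p.2 ≤ j := by
    refine le_of_mul_le_mul_left ?_ hi'
    nlinarith
  refine ⟨by simpa using h4, fun h => ?_⟩
  have hy : p.2 = j := by simpa using h
  refine Prod.ext (le_antisymm h2 ?_) hy
  rw [hy, mul_comm] at h3
  exact le_of_mul_le_mul_left h3 hj'

theorem extremePoint_not_diagonal {v : ℝ × ℝ} (hi : 0 < i) (hP : P ∈ gonsInDelta i j m)
    (hv : v ∈ P.extremePoints ℝ) (h0 : 0 < v.1) (h1 : v.1 < i) : v.2 ≠ j * v.1 / i := by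
  intro h
  have hd := diagonal_mem_segment j hi h0.le h1.le
  rw [← h] at hd
  have hL := diagonal_subset_of_mem_gonsInDelta hP
  rcases (mem_extremePoints_iff_forall_segment.1 hv).2 _ (hL (left_mem_segment _ _ _)) _
    (hL (right_mem_segment _ _ _)) hd with h | h
  · rw [← h] at h0; exact lt_irrefl _ h0
  · rw [← h] at h1; exact lt_irrefl _ h1

/-- No point of `P` lies vertically below an extreme point off the ends of the diagonal. -/
theorem eq_of_below_extremePoint {v : ℝ × ℝ} (hi : 0 < i) (hj : 0 < j) (hP : P ∈ gonsInDelta i j m)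
    (hv : v ∈ P.extremePoints ℝ) (h0 : 0 < v.1) (h1 : v.1 < i) {z : ℝ} (hz : (v.1, z) ∈ P)
    (hzv : z ≤ v.2) : z = v.2 := by
  have hi' : (0 : ℝ) < i := by exact_mod_cast hi
  obtain ⟨-, -, h3⟩ := (mem_triangleDelta hi hj).1 (hP.2.1 hv.1)
  have hup : v.2 ≤ j * v.1 / i := by rw [le_div_iff₀ hi']; linarith
  have hseg : v.2 ∈ segment ℝ z (j * v.1 / i) := by
    rw [segment_eq_Icc (hzv.trans hup)]; exact ⟨hzv, hup⟩
  -- `v` lies between two points of `P` on a vertical line, so it is one of them, and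
  -- `extremePoint_not_diagonal` excludes the upper one.
  have hmem : v ∈ segment ℝ (v.1, z) (v.1, (j * v.1 / i : ℝ)) := by
    obtain ⟨s, t, hs, ht, hst, h⟩ := hseg
    refine ⟨s, t, hs, ht, hst, ?_⟩
    ext
    · simp [← add_mul, hst]
    · simpa using h
  rcases (mem_extremePoints_iff_forall_segment.1 hv).2 _ hz _
    (diagonal_subset_of_mem_gonsInDelta hP (diagonal_mem_segment j hi h0.le h1.le)) hmem with h | h
  · exact congrArg Prod.snd h
  · exact absurd (congrArg Prod.snd h).symm (extremePoint_not_diagonal hi hP hv h0 h1)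

/-- This is where the condition on the legs enters: it excludes zero ordinate and abscissa `i`
except at the ends of `L`. -/
theorem extremePoint_cases {v : ℝ × ℝ} (hi : 0 < i) (hj : 0 < j) (hP : P ∈ gonsInDelta i j m)
    (hv : v ∈ P.extremePoints ℝ) :
    v = (0, 0) ∨ v = ((i : ℝ), (j : ℝ)) ∨ 0 < v.1 ∧ v.1 < i ∧ 0 < v.2 := by
  have hi' : (0 : ℝ) < i := by exact_mod_cast hi
  have hj' : (0 : ℝ) < j := by exact_mod_cast hj
  obtain ⟨h1, h2, h3⟩ := (mem_triangleDelta hi hj).1 (hP.2.1 hv.1)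
  have hp0 : 0 ≤ v.1 := by
    have : 0 ≤ (j : ℝ) * v.1 := le_trans (by positivity) h3
    exact nonneg_of_mul_nonneg_right this hj'
  have hleg : v ∈ legsDelta i j → v = (0, 0) ∨ v = ((i : ℝ), (j : ℝ)) :=
    fun h => hP.2.2.1 ⟨hv.1, h⟩
  rcases h1.eq_or_lt with hy | hy
  · have := hleg (by
      have := mem_legsDelta_of_snd_eq_zero (j := j) hi hp0 h2
      rwa [hy] at this)
    tauto
  rcases h2.eq_or_lt with hx | hx
  · have := hleg (by
      have := mem_legsDelta_of_fst_eq (i := i) hj h1 (by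
        rw [hx, mul_comm] at h3; exact le_of_mul_le_mul_right h3 hi')
      rwa [← hx] at this)
    tauto
  refine Or.inr (Or.inr ⟨?_, hx, hy⟩)
  have : 0 < (j : ℝ) * v.1 := lt_of_lt_of_le (by positivity) h3
  exact pos_of_mul_pos_right this hj'.le

theorem extremePoint_ext {v w : ℝ × ℝ} (hi : 0 < i) (hj : 0 < j) (hP : P ∈ gonsInDelta i j m)
    (hv : v ∈ P.extremePoints ℝ) (hw : w ∈ P.extremePoints ℝ) (h : v.1 = w.1) : v = w := by
  have hi' : (0 : ℝ) < i := by exact_mod_cast hi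
  rcases extremePoint_cases hi hj hP hv with rfl | rfl | ⟨hv0, hv1, -⟩ <;>
  rcases extremePoint_cases hi hj hP hw with rfl | rfl | ⟨hw0, hw1, -⟩ <;>
  first
  | rfl
  | (simp only at *; linarith)
  | skip
  refine Prod.ext h ?_
  rcases le_total v.2 w.2 with hle | hle
  · exact eq_of_below_extremePoint hi hj hP hw hw0 hw1 (h ▸ hv.1) hle
  · exact (eq_of_below_extremePoint hi hj hP hv hv0 hv1 (h ▸ hw.1) hle).symm

/-- Otherwise the chord from `u` to `w` passes through or below `v`. Since nothing in `P` lies below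
`v`, it passes through `v`, against extremality. -/
theorem extremePoint_slope_lt {u v w : ℝ × ℝ} (hi : 0 < i) (hj : 0 < j)
    (hP : P ∈ gonsInDelta i j m) (hu : u ∈ P.extremePoints ℝ) (hv : v ∈ P.extremePoints ℝ)
    (hw : w ∈ P.extremePoints ℝ) (huv : u.1 < v.1) (hvw : v.1 < w.1) :
    (v.2 - u.2) * (w.1 - v.1) < (w.2 - v.2) * (v.1 - u.1) := by
  by_contra! hcon
  have hd : 0 < w.1 - u.1 := by linarith
  have hsum : (w.1 - v.1) / (w.1 - u.1) + (v.1 - u.1) / (w.1 - u.1) = 1 := by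
    field_simp; ring
  set z := (w.1 - v.1) / (w.1 - u.1) * u.2 + (v.1 - u.1) / (w.1 - u.1) * w.2 with hz
  have hseg : (v.1, z) ∈ segment ℝ u w := by
    refine ⟨(w.1 - v.1) / (w.1 - u.1), (v.1 - u.1) / (w.1 - u.1), div_nonneg (by linarith) hd.le,
      div_nonneg (by linarith) hd.le, hsum, ?_⟩
    ext
    · simp; field_simp; ring
    · simp [hz]
  have hzP := (convex_of_mem_gonsInDelta hP).segment_subset hu.1 hw.1 hseg
  have hzv : z ≤ v.2 := by
    rw [hz, div_mul_eq_mul_div, div_mul_eq_mul_div, ← add_div, div_le_iff₀ hd]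
    linarith
  have h0 : 0 < v.1 := by
    rcases extremePoint_cases hi hj hP hv with rfl | rfl | ⟨h, -, -⟩
    · rcases extremePoint_cases hi hj hP hu with rfl | rfl | ⟨h, -, -⟩ <;> simp only at * <;>
        linarith [(Nat.cast_nonneg i : (0 : ℝ) ≤ i)]
    · exact Nat.cast_pos.2 hi
    · exact h
  have h1 : v.1 < i := by
    rcases extremePoint_cases hi hj hP hw with rfl | rfl | ⟨-, h, -⟩
    · simp only at *; linarith
    · exact hvw
    · linarith
  have := eq_of_below_extremePoint hi hj hP hv h0 h1 hzP hzv
  rw [this] at hseg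
  rcases (mem_extremePoints_iff_forall_segment.1 hv).2 _ hu.1 _ hw.1 hseg with h | h
  · rw [h] at huv; exact lt_irrefl _ huv
  · rw [h] at hvw; exact lt_irrefl _ hvw

theorem exists_extremePoints_eq_graph (hi : 0 < i) (hj : 0 < j)
    (hP : P ∈ gonsInDelta i j (k + 1)) :
    ∃ (T : Finset ℕ) (h : ℕ → ℕ), T.card = k + 1 ∧
      P.extremePoints ℝ = (fun a : ℕ => ((a : ℝ), (h a : ℝ))) '' T := by
  have hfin : (P.extremePoints ℝ).Finite :=
    Set.finite_of_ncard_ne_zero (by rw [hP.1.2.2.1]; omega)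
  have hnat : ∀ v ∈ P.extremePoints ℝ, v = ((⌊v.1⌋₊ : ℝ), (⌊v.2⌋₊ : ℝ)) := by
    intro v hv
    obtain ⟨⟨a, b⟩, rfl⟩ := hP.1.2.1 hv
    have hnn : (0 : ℝ) ≤ a ∧ (0 : ℝ) ≤ b := by
      rcases extremePoint_cases hi hj hP hv with h | h | ⟨h, -, h'⟩
      · rw [Prod.mk.injEq] at h; rw [h.1, h.2]; simp
      · rw [Prod.mk.injEq] at h; rw [h.1, h.2]; simp
      · exact ⟨h.le, h'.le⟩
    have ha : 0 ≤ a := by exact_mod_cast hnn.1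
    have hb : 0 ≤ b := by exact_mod_cast hnn.2
    lift a to ℕ using ha
    lift b to ℕ using hb
    simp
  have hex : ∀ a : ℕ, ∃ b : ℕ, (∃ v ∈ P.extremePoints ℝ, ⌊v.1⌋₊ = a) →
      ((a : ℝ), (b : ℝ)) ∈ P.extremePoints ℝ := by
    intro a
    by_cases ha : ∃ v ∈ P.extremePoints ℝ, ⌊v.1⌋₊ = a
    · obtain ⟨v, hv, rfl⟩ := ha
      exact ⟨⌊v.2⌋₊, fun _ => hnat v hv ▸ hv⟩
    -- The value `0` at other abscissas is arbitrary.
    · exact ⟨0, fun h => absurd h ha⟩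
  choose h hh using hex
  refine ⟨hfin.toFinset.image fun v => ⌊v.1⌋₊, h, ?_, ?_⟩
  · rw [Finset.card_image_of_injOn, ← Set.ncard_eq_toFinset_card _ hfin, hP.1.2.2.1]
    intro v hv w hw hvw
    rw [Finset.mem_coe, Set.Finite.mem_toFinset] at hv hw
    refine extremePoint_ext hi hj hP hv hw ?_
    rw [hnat v hv, hnat w hw]
    simpa using hvw
  · ext v
    simp only [Finset.coe_image, Set.Finite.coe_toFinset, Set.mem_image, exists_exists_and_eq_and]
    constructor
    · intro hv
      refine ⟨v, hv, extremePoint_ext hi hj hP (hh _ ⟨v, hv, rfl⟩) hv ?_⟩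
      exact (congrArg Prod.fst (hnat v hv)).symm
    · rintro ⟨w, hw, rfl⟩
      exact hh _ ⟨w, hw, rfl⟩

theorem surjOn_pathPolygon (hi : 0 < i) (hj : 0 < j) (hk : 1 ≤ k) :
    Set.SurjOn pathPolygon (slopeSequences i j k) (gonsInDelta i j (k + 1)) := by
  intro P hP
  obtain ⟨T, h, hcard, hS⟩ := exists_extremePoints_eq_graph hi hj hP
  have hmem : ∀ a ∈ T, ((a : ℝ), (h a : ℝ)) ∈ P.extremePoints ℝ :=
    fun a ha => hS ▸ ⟨a, ha, rfl⟩
  have hT0 : 0 ∈ T ∧ h 0 = 0 := by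
    have := zero_mem_extremePoints hi hj hP
    rw [hS] at this
    obtain ⟨a, ha, h1⟩ := this
    simp only [Prod.mk.injEq, Nat.cast_eq_zero] at h1
    obtain ⟨rfl, h1⟩ := h1
    exact ⟨ha, h1⟩
  have hTi : i ∈ T ∧ h i = j := by
    have := corner_mem_extremePoints hi hj hP
    rw [hS] at this
    obtain ⟨a, ha, h1⟩ := this
    simp only [Prod.mk.injEq, Nat.cast_inj] at h1
    obtain ⟨rfl, h1⟩ := h1
    exact ⟨ha, h1⟩
  have hTle : ∀ a ∈ T, a ≤ i := by
    intro a ha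
    have := ((mem_triangleDelta hi hj).1 (hP.2.1 (hmem a ha).1)).2.1
    exact Nat.cast_le.1 this
  have hconv : ∀ a ∈ T, ∀ b ∈ T, ∀ d ∈ T, a < b → b < d →
      ((h b : ℝ) - h a) * (d - b) < (h d - h b) * (b - a) := by
    intro a ha b hb d hd hab hbd
    exact extremePoint_slope_lt hi hj hP (hmem a ha) (hmem b hb) (hmem d hd)
      (by simpa using hab) (by simpa using hbd)
  have hpos : ∀ a ∈ T, 0 < a → 0 < h a := by
    intro a ha ha0
    rcases extremePoint_cases hi hj hP (hmem a ha) with h1 | h1 | ⟨-, -, h1⟩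
    · rw [Prod.mk.injEq, Nat.cast_eq_zero] at h1; omega
    · rw [Prod.mk.injEq, Nat.cast_inj, Nat.cast_inj] at h1; omega
    · exact Nat.cast_pos.1 h1
  have hmono : ∀ a ∈ T, ∀ b ∈ T, a < b → h a < h b := by
    intro a ha b hb hab
    rcases Nat.eq_zero_or_pos a with rfl | ha0
    · rw [hT0.2]; exact hpos b hb hab
    -- The chord from the origin to `a` has positive slope, and the next chord is steeper.
    · have h1 := hconv 0 hT0.1 a ha b hb ha0 hab
      have h2 : (0 : ℝ) < h a := by exact_mod_cast hpos a ha ha0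
      have h3 : (0 : ℝ) < b - a := by rw [sub_pos]; exact_mod_cast hab
      have h4 : (0 : ℝ) < a := by exact_mod_cast ha0
      rw [hT0.2] at h1
      simp only [Nat.cast_zero, sub_zero] at h1
      have h5 := pos_of_mul_pos_left ((mul_pos h2 h3).trans h1) h4.le
      rw [sub_pos] at h5
      exact_mod_cast h5
  set e := T.orderEmbOfFin hcard with he
  have heT : ∀ n, e n ∈ T := fun n => T.orderEmbOfFin_mem hcard n
  have hrange : Set.range e = T := T.range_orderEmbOfFin hcard
  have he0 : e 0 = 0 := by
    obtain ⟨n, hn⟩ : 0 ∈ Set.range e := hrange ▸ hT0.1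
    have := e.monotone (Fin.zero_le n)
    omega
  have hei : e (Fin.last k) = i := by
    obtain ⟨n, hn⟩ : i ∈ Set.range e := hrange ▸ hTi.1
    have := e.monotone (Fin.le_last n)
    have := hTle _ (heT (Fin.last k))
    omega
  have helt : ∀ l : Fin k, e l.castSucc < e l.succ := fun l => e.strictMono Fin.castSucc_lt_succ
  have hhlt : ∀ l : Fin k, h (e l.castSucc) < h (e l.succ) :=
    fun l => hmono _ (heT _) _ (heT _) (helt l)
  -- By `helt` and `hhlt` these natural subtractions do not truncate.
  let c : Fin k → ℕ × ℕ := fun l => (e l.succ - e l.castSucc, h (e l.succ) - h (e l.castSucc))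
  have hc1 : ∀ l, ((c l).1 : ℝ) = e l.succ - e l.castSucc := fun l => Nat.cast_sub (helt l).le
  have hc2 : ∀ l, ((c l).2 : ℝ) = h (e l.succ) - h (e l.castSucc) :=
    fun l => Nat.cast_sub (hhlt l).le
  have hvert : ∀ n, pathVertex c n = ((e n : ℝ), (h (e n) : ℝ)) := by
    intro n
    induction n using Fin.induction with
    | zero => rw [pathVertex_zero, he0, hT0.2]; simp
    | succ l ih => rw [pathVertex_succ, ih, hc1, hc2]; simp
  have hlast := pathVertex_last c
  rw [hvert, hei, hTi.2, Prod.mk.injEq, Nat.cast_inj, Nat.cast_inj] at hlast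
  refine ⟨c, ⟨fun l => ⟨Nat.sub_pos_of_lt (helt l), Nat.sub_pos_of_lt (hhlt l)⟩, hlast.1.symm,
    hlast.2.symm, ?_⟩, ?_⟩
  -- With `k` a successor, monotonicity reduces to adjacent steps, that is, to three consecutive
  -- extreme points.
  · obtain ⟨k, rfl⟩ : ∃ k', k = k' + 1 := ⟨k - 1, by omega⟩
    refine Fin.strictMono_iff_lt_succ.2 fun l => ?_
    have h1 := hconv _ (heT l.castSucc.castSucc) _ (heT l.castSucc.succ) _ (heT l.succ.succ)
      (helt _) (helt l.succ)
    have h2 := hc1 l.castSucc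
    have h3 := hc2 l.castSucc
    have h4 := hc1 l.succ
    have h5 := hc2 l.succ
    rw [← Fin.succ_castSucc] at h4 h5
    rw [← h2, ← h3, ← h4, ← h5] at h1
    rw [div_lt_div_iff₀ (by exact_mod_cast Nat.sub_pos_of_lt (helt _))
      (by exact_mod_cast Nat.sub_pos_of_lt (helt _))]
    exact_mod_cast h1
  · rw [hP.1.2.2.2, hS, pathPolygon, ← hrange, ← Set.range_comp]
    exact congrArg (fun f => convexHull ℝ (Set.range f)) (funext hvert)

end Surjectivity

theorem lemma1p3 (i j k : ℕ) (hi : 0 < i) (hj : 0 < j) (hk : 1 ≤ k) :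
    Set.BijOn pathPolygon (slopeSequences i j k) (gonsInDelta i j (k + 1)) ∧
    ∀ c ∈ slopeSequences i j k,
      (1 / 2 : ℝ) *
          (∑ l₁, ∑ l₂ ∈ Finset.Ioi l₁,
              (((c l₁).1 : ℝ) * ((c l₂).2 : ℝ) - ((c l₂).1 : ℝ) * ((c l₁).2 : ℝ)) +
            ∑ l, (Nat.gcd (c l).1 (c l).2 : ℝ)) =
        (interiorCount (pathPolygon c) : ℝ) + (boundaryCount (pathPolygon c) : ℝ) - 1 -
          (1 / 2 : ℝ) * (Nat.gcd i j : ℝ) := by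
  exact ⟨⟨fun _ hc => pathPolygon_mem_gonsInDelta hi hj hk hc, injOn_pathPolygon,
    surjOn_pathPolygon hi hj hk⟩, fun _ hc => half_area_add_gcd_eq hi hk hc⟩
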